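/- Let $n\ge 2$, let $\Omega\subset\mathbb{R}^n$ be a domain (non-empty, open and connected), and let $E\subset\Omega$ be closed in $\Omega$ with $(n-1)$-dimensional Hausdorff measure $\mathcal{H}^{n-1}(E)=0$. Let $u:\Omega\setminus E\to\mathbb{R}$ be subharmonic and such that (i) $u\in\mathcal{L}^1_{\mathrm{loc}}(\Omega)$; (ii) $u\in\mathcal{C}^2(\Omega\setminus E)$; (iii) for each $j$, $1\le j\le n$, the (classical) second partial derivative $\frac{\partial^2u}{\partial x_j^2}$, defined on $\Omega\setminus E$, belongs to $\mathcal{L}^1_{\mathrm{loc}}(\Omega)$. Then $u$ has a subharmonic extension to $\Omega$, that is, there is a subharmonic function $v:\Omega\to[-\infty,\infty)$ with $v=u$ on $\Omega\setminus E$. Here a function $f:U\to[-\infty,\infty)$ on an open set $U\subset\mathbb{R}^n$ is called subharmonic if it is upper semicontinuous, is not identically $-\infty$ on any connected component of $U$, and satisfies $f(x)\le\frac{1}{|B|}\int_B f(y)\,dy$ for every closed ball $B\subset U$ of positive radius and centre $x$. In (i) and (iii), a function $g$ defined on $\Omega\setminus E$ belongs to $\mathcal{L}^1_{\mathrm{loc}}(\Omega)$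 if every point of $\Omega$ has a neighbourhood $V\subset\Omega$ with $\int_{V\setminus E}|g|\,dx<\infty$ (the set $E$ has Lebesgue measure zero). -/

import Mathlib

open MeasureTheory

noncomputable section

/-- The integral `∫ f⁺ dμ - ∫ f⁻ dμ` of an extended-real-valued function. It has its usual meaning
as soon as one of the two terms is finite; this is always so for an upper semicontinuous function
with values in `[-∞, ∞)` on a closed ball, since such a function is bounded above there. -/
def extIntegral {X : Type*} [MeasurableSpace X] (μ : Measure X) (f : X → EReal) : EReal :=
  ((∫⁻ y, (f y).toENNReal ∂μ : ENNReal) : EReal) - ((∫⁻ y, (-f y).toENNReal ∂μ : ENNReal) : EReal)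

/-- The mean value of `f` over the closed ball with centre `x` and radius `r`, with respect to
Lebesgue measure. -/
def ballMean {n : ℕ} (f : EuclideanSpace ℝ (Fin n) → EReal) (x : EuclideanSpace ℝ (Fin n))
    (r : ℝ) : EReal :=
  extIntegral (volume.restrict (Metric.closedBall x r)) f /
    ((volume.real (Metric.closedBall x r) : ℝ) : EReal)

/-- `f` is subharmonic on the open set `U`: on `U` it takes values in `[-∞, ∞)`, is upper
semicontinuous, is bounded at each `x ∈ U` by its means over all closed balls in `U` centred at `x`,
and is not identically `-∞` on any connected component of `U`. Only the values of `f` on `U`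
matter. -/
structure SubharmonicOn {n : ℕ} (f : EuclideanSpace ℝ (Fin n) → EReal)
    (U : Set (EuclideanSpace ℝ (Fin n))) : Prop where
  lt_top : ∀ x ∈ U, f x < ⊤
  upperSemicontinuousOn : UpperSemicontinuousOn f U
  le_ballMean : ∀ x ∈ U, ∀ r : ℝ, 0 < r → Metric.closedBall x r ⊆ U → f x ≤ ballMean f x r
  exists_ne_bot : ∀ x ∈ U, ∃ y ∈ connectedComponentIn U x, f y ≠ ⊥

/-- The first partial derivative `∂f/∂x_j`. -/
def partialDeriv {n : ℕ} (j : Fin n) (f : EuclideanSpace ℝ (Fin n) → ℝ) :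
    EuclideanSpace ℝ (Fin n) → ℝ :=
  fun x => lineDeriv ℝ f x (EuclideanSpace.single j (1 : ℝ))

end

open Set Filter Topology

/-! ### Integration by parts along lines avoiding a small set -/

/-! The set `E` is invisible to the distributional Laplacian of `u`. Projection along a coordinate
axis is Lipschitz, so `E` has Lebesgue-null shadow and almost every line parallel to that axis
misses it entirely. On such a line `u` is C² on the whole slice of `Ω`, so two integrations by parts
against a test function leave no boundary terms, and Fubini gives the identity on `Ω`
(`integral_mul_partialDeriv_partialDeriv`). Only `u` and its pure second derivatives need be
integrable.

Off `E` the sub-mean-value inequality forces the classical Laplacian to be nonnegative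
(`sum_partialDeriv_partialDeriv_nonneg_of_le_setAverage`). As `E` is null, `u` has nonnegative
distributional Laplacian on all of `Ω`. Testing with radial functions shows that its ball means
increase with the radius (`WeaklySubharmonicOn.setAverage_mono`).

The extension is the infimum of the ball means at each centre. It is upper semicontinuous because
each mean is continuous in the centre, and it agrees with `u` wherever `u` is continuous, hence off
`E`. Its own ball means are therefore those of `u`, and its mean value inequality is the definition
of the infimum. -/

/-- The integrand is the derivative of the compactly supported Wronskian `f g' - f' g`. Nothing is
known about `f` outside `I`, but there `g` and its derivatives vanish locally. -/
theorem integral_mul_second_deriv_sub_eq_zero {f f' f'' g g' g'' : ℝ → ℝ} {I : Set ℝ}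
    (hI : IsOpen I) (hf : ∀ t ∈ I, HasDerivAt f (f' t) t) (hf' : ∀ t ∈ I, HasDerivAt f' (f'' t) t)
    (hf'' : ContinuousOn f'' I) (hg : ∀ t, HasDerivAt g (g' t) t)
    (hg' : ∀ t, HasDerivAt g' (g'' t) t) (hg'' : Continuous g'') (hc : HasCompactSupport g)
    (hsub : tsupport g ⊆ I) : ∫ t, (f t * g'' t - f'' t * g t) = 0 := by
  have g0 : ∀ t ∉ tsupport g, ∀ᶠ s in 𝓝 t, g s = 0 ∧ g' s = 0 ∧ g'' s = 0 := by
    intro t ht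
    have h0 : ∀ᶠ s in 𝓝 t, g s = 0 := notMem_tsupport_iff_eventuallyEq.1 ht
    have h1 : ∀ᶠ s in 𝓝 t, g' s = 0 := by
      filter_upwards [h0.eventually_nhds] with s hs
      exact (hg s).unique ((hasDerivAt_const s (0 : ℝ)).congr_of_eventuallyEq hs)
    have h2 : ∀ᶠ s in 𝓝 t, g'' s = 0 := by
      filter_upwards [h1.eventually_nhds] with s hs
      exact (hg' s).unique ((hasDerivAt_const s (0 : ℝ)).congr_of_eventuallyEq hs)
    filter_upwards [h0, h1, h2] with s a b c using ⟨a, b, c⟩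
  have hw : ∀ t, HasDerivAt (fun t => f t * g' t - f' t * g t) (f t * g'' t - f'' t * g t) t := by
    intro t
    by_cases ht : t ∈ tsupport g
    · have h := ((hf t (hsub ht)).mul (hg' t)).sub ((hf' t (hsub ht)).mul (hg t))
      refine h.congr_deriv ?_
      ring
    · have h := g0 t ht
      obtain ⟨a, b, c⟩ := h.self_of_nhds
      rw [a, c]
      simp only [mul_zero, sub_zero]
      refine (hasDerivAt_const t (0 : ℝ)).congr_of_eventuallyEq ?_
      filter_upwards [h] with s hs
      simp [hs.1, hs.2.1]
  have hcont : Continuous fun t => f t * g'' t - f'' t * g t := by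
    rw [continuous_iff_continuousAt]
    intro t
    by_cases ht : t ∈ tsupport g
    · have hn := hI.mem_nhds (hsub ht)
      exact ((hf t (hsub ht)).continuousAt.mul hg''.continuousAt).sub
        ((hf''.continuousAt hn).mul (hg t).continuousAt)
    · refine (continuousAt_const (y := (0 : ℝ))).congr ?_
      filter_upwards [g0 t ht] with s hs
      simp [hs.1, hs.2.2]
  have hwc : Continuous fun t => f t * g' t - f' t * g t :=
    continuous_iff_continuousAt.2 fun t => (hw t).continuousAt
  refine integral_eq_zero_of_hasDerivAt_of_integrable hw
    (hcont.integrable_of_hasCompactSupport ?_) (hwc.integrable_of_hasCompactSupport ?_)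
  · refine HasCompactSupport.intro hc fun t ht => ?_
    obtain ⟨a, b, c⟩ := (g0 t ht).self_of_nhds
    simp [a, c]
  · refine HasCompactSupport.intro hc fun t ht => ?_
    obtain ⟨a, b, c⟩ := (g0 t ht).self_of_nhds
    simp [a, b]

theorem partialDeriv_eq_fderiv {n : ℕ} {f : EuclideanSpace ℝ (Fin n) → ℝ}
    {x : EuclideanSpace ℝ (Fin n)} (j : Fin n) (h : DifferentiableAt ℝ f x) :
    partialDeriv j f x = fderiv ℝ f x (EuclideanSpace.single j 1) :=
  h.lineDeriv_eq_fderiv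

theorem ContDiffOn.partialDeriv {n : ℕ} {f : EuclideanSpace ℝ (Fin n) → ℝ}
    {U : Set (EuclideanSpace ℝ (Fin n))} {k : WithTop ℕ∞} (hU : IsOpen U)
    (h : ContDiffOn ℝ (k + 1) f U) (j : Fin n) : ContDiffOn ℝ k (partialDeriv j f) U := by
  refine ((h.fderiv_of_isOpen hU le_rfl).clm_apply
    (contDiffOn_const (c := EuclideanSpace.single j (1 : ℝ)))).congr fun x hx => ?_
  refine partialDeriv_eq_fderiv j ((h.differentiableOn ?_).differentiableAt (hU.mem_nhds hx))
  simp

theorem ContDiff.partialDeriv {n : ℕ} {f : EuclideanSpace ℝ (Fin n) → ℝ} {k : WithTop ℕ∞}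
    (h : ContDiff ℝ (k + 1) f) (j : Fin n) : ContDiff ℝ k (partialDeriv j f) :=
  contDiffOn_univ.1 ((contDiffOn_univ.2 h).partialDeriv isOpen_univ j)

/-- The point of `ℝⁿ⁺¹` with `j`-th coordinate `t` and the other coordinates given by `y`. -/
def coordLine {m : ℕ} (j : Fin (m + 1)) (y : Fin m → ℝ) (t : ℝ) :
    EuclideanSpace ℝ (Fin (m + 1)) :=
  WithLp.toLp 2 (Fin.insertNth (α := fun _ => ℝ) j t y)

theorem coordLine_eq {m : ℕ} (j : Fin (m + 1)) (y : Fin m → ℝ) (t : ℝ) :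
    coordLine j y t = coordLine j y 0 + t • EuclideanSpace.single j (1 : ℝ) := by
  ext i
  refine Fin.succAboveCases j ?_ (fun i => ?_) i
  · simp [coordLine]
  · simp [coordLine]

theorem continuous_coordLine {m : ℕ} (j : Fin (m + 1)) (y : Fin m → ℝ) :
    Continuous (coordLine j y) := by
  have : coordLine j y = fun t => coordLine j y 0 + t • EuclideanSpace.single j (1 : ℝ) :=
    funext (coordLine_eq j y)
  rw [this]
  fun_prop

theorem hasDerivAt_comp_coordLine {m : ℕ} (j : Fin (m + 1)) (y : Fin m → ℝ) {t : ℝ}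
    {f : EuclideanSpace ℝ (Fin (m + 1)) → ℝ} (h : DifferentiableAt ℝ f (coordLine j y t)) :
    HasDerivAt (fun s => f (coordLine j y s)) (partialDeriv j f (coordLine j y t)) t := by
  rw [partialDeriv_eq_fderiv j h]
  have hl : HasDerivAt (coordLine j y) (EuclideanSpace.single j (1 : ℝ)) t := by
    have : coordLine j y = fun t => coordLine j y 0 + t • EuclideanSpace.single j (1 : ℝ) :=
      funext (coordLine_eq j y)
    rw [this]
    simpa using ((hasDerivAt_id t).smul_const (EuclideanSpace.single j (1 : ℝ))).const_add
      (coordLine j y 0)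
  exact h.hasFDerivAt.comp_hasDerivAt t hl

/-- A set of vanishing `m`-dimensional measure in `ℝᵐ⁺¹` misses almost every line parallel to a
coordinate axis. -/
theorem ae_forall_coordLine_notMem {m : ℕ} (j : Fin (m + 1))
    {E : Set (EuclideanSpace ℝ (Fin (m + 1)))} (hE : Measure.hausdorffMeasure (m : ℝ) E = 0) :
    ∀ᵐ y : Fin m → ℝ, ∀ t, coordLine j y t ∉ E := by
  let P : EuclideanSpace ℝ (Fin (m + 1)) → Fin m → ℝ := fun x i => x (j.succAbove i)
  -- The target carries the sup norm, for which `m`-dimensional Hausdorff measure on `Fin m → ℝ` is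
  -- Lebesgue measure.
  have hP : LipschitzWith 1 P := by
    refine LipschitzWith.of_dist_le_mul fun x y => ?_
    rw [NNReal.coe_one, one_mul, dist_pi_le_iff dist_nonneg]
    intro i
    exact (dist_le_pi_dist (WithLp.ofLp x) (WithLp.ofLp y) (j.succAbove i)).trans
      (by simpa using (PiLp.lipschitzWith_ofLp 2 (fun _ : Fin (m + 1) => ℝ)).dist_le_mul x y)
  have h0 : volume (P '' E) = 0 := by
    have h := hP.hausdorffMeasure_image_le (Nat.cast_nonneg m) E
    rw [hE, mul_zero, nonpos_iff_eq_zero] at h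
    rw [← hausdorffMeasure_pi_real, Fintype.card_fin]
    exact h
  filter_upwards [measure_eq_zero_iff_ae_notMem.1 h0] with y hy t ht
  refine hy ⟨_, ht, ?_⟩
  ext i
  simp [P, coordLine]

theorem integral_eq_integral_coordLine {m : ℕ} (j : Fin (m + 1))
    {h : EuclideanSpace ℝ (Fin (m + 1)) → ℝ} (hh : Integrable h) :
    ∫ x, h x = ∫ y : Fin m → ℝ, ∫ t : ℝ, h (coordLine j y t) := by
  let e : EuclideanSpace ℝ (Fin (m + 1)) ≃ᵐ ℝ × (Fin m → ℝ) :=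
    (MeasurableEquiv.toLp 2 (Fin (m + 1) → ℝ)).symm.trans
      (MeasurableEquiv.piFinSuccAbove (fun _ => ℝ) j)
  have he : MeasurePreserving e volume volume :=
    (EuclideanSpace.volume_preserving_symm_measurableEquiv_toLp (Fin (m + 1))).trans
      (volume_preserving_piFinSuccAbove (fun _ => ℝ) j)
  have hs := he.symm
  have hi : Integrable (h ∘ e.symm) ((volume : Measure ℝ).prod (volume : Measure (Fin m → ℝ))) :=
    (hs.integrable_comp_emb e.symm.measurableEmbedding).2 hh
  rw [← hs.integral_comp' h]
  exact integral_prod_symm _ hi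

theorem MeasureTheory.LocallyIntegrableOn.integrable_mul_of_compact {n : ℕ}
    {f g : EuclideanSpace ℝ (Fin n) → ℝ} {Ω K : Set (EuclideanSpace ℝ (Fin n))}
    (hf : LocallyIntegrableOn f Ω) (hK : IsCompact K) (hKΩ : K ⊆ Ω) (hg : Continuous g)
    (h0 : ∀ x ∉ K, g x = 0) : Integrable fun x => f x * g x := by
  have h := (hf.integrableOn_compact_subset hKΩ hK).mul_continuousOn hg.continuousOn hK
  refine (integrableOn_iff_integrable_of_support_subset fun x hx => ?_).1 h
  by_contra hxK
  exact hx (by simp [h0 x hxK])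

theorem partialDeriv_eq_zero_of_notMem_tsupport {n : ℕ} {φ : EuclideanSpace ℝ (Fin n) → ℝ}
    (j : Fin n) {x : EuclideanSpace ℝ (Fin n)} (hx : x ∉ tsupport φ) :
    partialDeriv j φ x = 0 := by
  have h : φ =ᶠ[𝓝 x] fun _ => 0 := notMem_tsupport_iff_eventuallyEq.1 hx
  rw [partialDeriv, h.lineDeriv_eq]
  simp [lineDeriv]

theorem partialDeriv_partialDeriv_eq_zero_of_notMem_tsupport {n : ℕ}
    {φ : EuclideanSpace ℝ (Fin n) → ℝ} (j : Fin n) {x : EuclideanSpace ℝ (Fin n)}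
    (hx : x ∉ tsupport φ) : partialDeriv j (partialDeriv j φ) x = 0 := by
  refine partialDeriv_eq_zero_of_notMem_tsupport j fun h => hx ?_
  refine closure_minimal (fun y hy => ?_) (isClosed_tsupport φ) h
  by_contra hy'
  exact hy (partialDeriv_eq_zero_of_notMem_tsupport j hy')

theorem integral_mul_partialDeriv_partialDeriv {m : ℕ} (j : Fin (m + 1))
    {Ω E : Set (EuclideanSpace ℝ (Fin (m + 1)))} (hΩ : IsOpen Ω) (hU : IsOpen (Ω \ E))
    (hE : Measure.hausdorffMeasure (m : ℝ) E = 0) {u φ : EuclideanSpace ℝ (Fin (m + 1)) → ℝ}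
    (hu : LocallyIntegrableOn u Ω) (hu2 : ContDiffOn ℝ 2 u (Ω \ E))
    (hu3 : LocallyIntegrableOn (partialDeriv j (partialDeriv j u)) Ω)
    (hφ : ContDiff ℝ 2 φ) (hc : HasCompactSupport φ) (hsub : tsupport φ ⊆ Ω) :
    ∫ x, u x * partialDeriv j (partialDeriv j φ) x =
      ∫ x, partialDeriv j (partialDeriv j u) x * φ x := by
  have two : (2 : WithTop ℕ∞) = 1 + 1 := by norm_num
  have one : (1 : WithTop ℕ∞) = 0 + 1 := by norm_num
  have hφ1 : ContDiff ℝ 1 (partialDeriv j φ) := by rw [two] at hφ; exact hφ.partialDeriv j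
  have hφ2 : Continuous (partialDeriv j (partialDeriv j φ)) := by
    rw [one] at hφ1; exact (hφ1.partialDeriv j).continuous
  have hu21 : ContDiffOn ℝ 1 (partialDeriv j u) (Ω \ E) := by
    rw [two] at hu2; exact hu2.partialDeriv hU j
  have hu22 : ContinuousOn (partialDeriv j (partialDeriv j u)) (Ω \ E) := by
    rw [one] at hu21; exact (hu21.partialDeriv hU j).continuousOn
  have i1 : Integrable fun x => u x * partialDeriv j (partialDeriv j φ) x :=
    hu.integrable_mul_of_compact hc hsub hφ2
      fun x hx => partialDeriv_partialDeriv_eq_zero_of_notMem_tsupport j hx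
  have i2 : Integrable fun x => partialDeriv j (partialDeriv j u) x * φ x :=
    hu3.integrable_mul_of_compact hc hsub hφ.continuous
      fun x hx => image_eq_zero_of_notMem_tsupport hx
  rw [← sub_eq_zero, ← integral_sub i1 i2]
  refine (integral_eq_integral_coordLine j (i1.sub i2)).trans (integral_eq_zero_of_ae ?_)
  filter_upwards [ae_forall_coordLine_notMem j hE] with y hy
  have hl := continuous_coordLine j y
  have hmem : ∀ {t}, coordLine j y t ∈ Ω → coordLine j y t ∈ Ω \ E := fun h => ⟨h, hy _⟩
  have hts : tsupport (fun t => φ (coordLine j y t)) ⊆ coordLine j y ⁻¹' tsupport φ :=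
    tsupport_comp_subset_preimage φ hl
  have hemb : IsClosedEmbedding (coordLine j y) := by
    have hli : Function.LeftInverse (fun x : EuclideanSpace ℝ (Fin (m + 1)) => x j) (coordLine j y) := by
      intro t; simp [coordLine]
    exact hli.isClosedEmbedding (by fun_prop) hl
  refine integral_mul_second_deriv_sub_eq_zero
    (f := fun t => u (coordLine j y t)) (f' := fun t => partialDeriv j u (coordLine j y t))
    (f'' := fun t => partialDeriv j (partialDeriv j u) (coordLine j y t))
    (g := fun t => φ (coordLine j y t)) (g' := fun t => partialDeriv j φ (coordLine j y t))
    (g'' := fun t => partialDeriv j (partialDeriv j φ) (coordLine j y t))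
    (I := coordLine j y ⁻¹' Ω) (hΩ.preimage hl) ?_ ?_ ?_ ?_ ?_ (hφ2.comp hl) ?_ ?_
  · exact fun t ht => hasDerivAt_comp_coordLine j y
      ((hu2.differentiableOn (by simp)).differentiableAt (hU.mem_nhds (hmem ht)))
  · exact fun t ht => hasDerivAt_comp_coordLine j y
      ((hu21.differentiableOn (by simp)).differentiableAt (hU.mem_nhds (hmem ht)))
  · exact hu22.comp hl.continuousOn fun t ht => hmem ht
  · exact fun t => hasDerivAt_comp_coordLine j y (hφ.differentiable (by simp) _)
  · exact fun t => hasDerivAt_comp_coordLine j y (hφ1.differentiable (by simp) _)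
  · exact hc.comp_isClosedEmbedding hemb
  · exact hts.trans (preimage_mono hsub)

/-! ### Weakly subharmonic functions and monotonicity of ball means -/

/-- `f` has nonnegative distributional Laplacian on `Ω`. -/
def WeaklySubharmonicOn {n : ℕ} (f : EuclideanSpace ℝ (Fin n) → ℝ)
    (Ω : Set (EuclideanSpace ℝ (Fin n))) : Prop :=
  ∀ φ : EuclideanSpace ℝ (Fin n) → ℝ, ContDiff ℝ 2 φ → HasCompactSupport φ → tsupport φ ⊆ Ω →
    (∀ x, 0 ≤ φ x) → 0 ≤ ∫ x, f x * ∑ j, partialDeriv j (partialDeriv j φ) x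

theorem hasDerivAt_norm_sub_sq_line {n : ℕ} (x y : EuclideanSpace ℝ (Fin n)) (j : Fin n) :
    HasDerivAt (fun s : ℝ => ‖y + s • EuclideanSpace.single j (1 : ℝ) - x‖ ^ 2)
      (2 * (y j - x j)) 0 := by
  have h : HasDerivAt (fun s : ℝ => y + s • EuclideanSpace.single j (1 : ℝ) - x)
      (EuclideanSpace.single j (1 : ℝ)) 0 := by
    simpa using (((hasDerivAt_id (0 : ℝ)).smul_const
      (EuclideanSpace.single j (1 : ℝ))).const_add y).sub_const x
  refine h.norm_sq.congr_deriv ?_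
  simp [EuclideanSpace.inner_single_right]

theorem hasDerivAt_radial_line {n : ℕ} {g : ℝ → ℝ} {g' t : ℝ} (x y : EuclideanSpace ℝ (Fin n))
    (j : Fin n) (hg : HasDerivAt g g' (‖y - x‖ ^ 2 / t ^ 2)) :
    HasDerivAt (fun s : ℝ => g (‖y + s • EuclideanSpace.single j (1 : ℝ) - x‖ ^ 2 / t ^ 2))
      (g' * (2 * (y j - x j) / t ^ 2)) 0 := by
  have h := (hasDerivAt_norm_sub_sq_line x y j).div_const (t ^ 2)
  exact HasDerivAt.comp (0 : ℝ) (by simpa using hg) h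

/-- Chain rule; the squares of the coordinates of `y - x` sum to the squared norm. -/
theorem sum_partialDeriv_partialDeriv_radial {n : ℕ} {H η η' : ℝ → ℝ} {t : ℝ}
    (hH : ∀ s, HasDerivAt H (-η s) s) (hη : ∀ s, HasDerivAt η (η' s) s)
    (x y : EuclideanSpace ℝ (Fin n)) :
    ∑ j, partialDeriv j (partialDeriv j fun y => H (‖y - x‖ ^ 2 / t ^ 2)) y =
      -(2 / t ^ 2) * (n * η (‖y - x‖ ^ 2 / t ^ 2) +
        2 * (‖y - x‖ ^ 2 / t ^ 2) * η' (‖y - x‖ ^ 2 / t ^ 2)) := by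
  have h1 : ∀ j : Fin n, partialDeriv j (fun y => H (‖y - x‖ ^ 2 / t ^ 2)) =
      fun y => -η (‖y - x‖ ^ 2 / t ^ 2) * (2 * (y j - x j) / t ^ 2) := by
    intro j
    ext y
    exact (hasDerivAt_radial_line x y j (hH _)).deriv
  have h2 : ∀ j : Fin n, partialDeriv j (partialDeriv j fun y => H (‖y - x‖ ^ 2 / t ^ 2)) y =
      -(2 / t ^ 2) * (η (‖y - x‖ ^ 2 / t ^ 2) +
        2 * ((y j - x j) ^ 2 / t ^ 2) * η' (‖y - x‖ ^ 2 / t ^ 2)) := by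
    intro j
    rw [h1 j]
    have ha := (hasDerivAt_radial_line (t := t) x y j (hη _)).neg
    have hb : HasDerivAt (fun s : ℝ => 2 * ((y + s • EuclideanSpace.single j (1 : ℝ)) j - x j)
        / t ^ 2) (2 / t ^ 2) 0 := by
      simp only [PiLp.add_apply, PiLp.smul_apply, PiLp.single_apply, if_true,
        smul_eq_mul, mul_one]
      simpa using ((((hasDerivAt_id (0 : ℝ)).const_add (y j)).sub_const (x j)).const_mul
        2).div_const (t ^ 2)
    refine (ha.mul hb).deriv.trans ?_
    simp
    ring
  simp_rw [h2]
  rw [← Finset.mul_sum, Finset.sum_add_distrib, Finset.sum_const, Finset.card_univ,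
    Fintype.card_fin, nsmul_eq_mul, ← Finset.sum_mul, ← Finset.mul_sum, ← Finset.sum_div,
    EuclideanSpace.real_norm_sq_eq]
  simp

/-- The scaled radial kernel `t⁻ⁿ η(|y - x|² / t²)`. -/
noncomputable def radialKernel {n : ℕ} (η : ℝ → ℝ) (x : EuclideanSpace ℝ (Fin n)) (t : ℝ)
    (y : EuclideanSpace ℝ (Fin n)) : ℝ :=
  (t ^ n)⁻¹ * η (‖y - x‖ ^ 2 / t ^ 2)

/-- The derivative is written as the positive factor `t⁻ⁿ · t / 2` times the Laplacian in `y` of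
`H(|y - x|² / t²)`, where `H' = -η`. This turns monotonicity in `t` into positivity of a Laplacian.
-/
theorem hasDerivAt_radialKernel {n : ℕ} {η η' : ℝ → ℝ} (hη : ∀ s, HasDerivAt η (η' s) s)
    (x y : EuclideanSpace ℝ (Fin n)) {t : ℝ} (ht : 0 < t) :
    HasDerivAt (fun t => radialKernel η x t y)
      (((t ^ n)⁻¹ * (t / 2)) * (-(2 / t ^ 2) * (n * η (‖y - x‖ ^ 2 / t ^ 2) +
        2 * (‖y - x‖ ^ 2 / t ^ 2) * η' (‖y - x‖ ^ 2 / t ^ 2)))) t := by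
  have h1 : HasDerivAt (fun t : ℝ => (t ^ n)⁻¹) (-(n * t ^ (n - 1)) / (t ^ n) ^ 2) t :=
    (hasDerivAt_pow n t).fun_inv (by positivity)
  have h2 : HasDerivAt (fun t : ℝ => ‖y - x‖ ^ 2 / t ^ 2)
      (-(2 * (‖y - x‖ ^ 2 / t ^ 2) / t)) t := by
    have := ((hasDerivAt_pow 2 t).fun_inv (by positivity)).const_mul (‖y - x‖ ^ 2)
    simp only [← div_eq_mul_inv] at this
    refine this.congr_deriv ?_
    field_simp
    norm_num
    ring
  refine (h1.mul ((hη _).comp t h2)).congr_deriv ?_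
  have hn : (n : ℝ) * t ^ (n - 1) = n * t ^ n / t := by
    rcases n with _ | n
    · simp
    · rw [Nat.add_sub_cancel, pow_succ]; field_simp
  rw [hn]
  simp only [Function.comp]
  field_simp
  ring

/-- The derivative in `t` is a positive multiple of `f` integrated against the Laplacian of a
nonnegative radial test function. -/
theorem WeaklySubharmonicOn.monotoneOn_integral_radialKernel {n : ℕ}
    {f : EuclideanSpace ℝ (Fin n) → ℝ} {Ω : Set (EuclideanSpace ℝ (Fin n))}
    (hf : WeaklySubharmonicOn f Ω) {x : EuclideanSpace ℝ (Fin n)} {R : ℝ}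
    (hR : Metric.closedBall x R ⊆ Ω) (hi : IntegrableOn f (Metric.closedBall x R))
    {η : ℝ → ℝ} (hη : ContDiff ℝ 1 η) (hη0 : ∀ s, 0 ≤ η s) (hη1 : ∀ s, 1 ≤ s → η s = 0) :
    MonotoneOn (fun t => ∫ y in Metric.closedBall x R, f y * radialKernel η x t y)
      (Ioo 0 R) := by
  set η' := deriv η with hη'
  have hηd : ∀ s, HasDerivAt η (η' s) s := fun s =>
    (hη.differentiable (by simp) s).hasDerivAt
  have hη'c : Continuous η' := hη.continuous_deriv le_rfl
  have hηc : Continuous η := hη.continuous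
  -- The base point 1 makes `H` vanish on `[1, ∞)`, so that `H(|y - x|² / t²)` is supported in the
  -- ball of radius `t`.
  let H : ℝ → ℝ := fun s => ∫ a in s..1, η a
  have hH : ∀ s, HasDerivAt H (-η s) s := fun s =>
    intervalIntegral.integral_hasDerivAt_left (hηc.intervalIntegrable _ _)
      hηc.stronglyMeasurable.stronglyMeasurableAtFilter hηc.continuousAt
  have hH1 : ∀ s, 1 ≤ s → H s = 0 := by
    intro s hs
    have : H s = ∫ a in s..1, (0 : ℝ) := by
      refine intervalIntegral.integral_congr fun a ha => hη1 a ?_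
      rw [uIcc_of_ge hs] at ha
      exact ha.1
    simp [this]
  have hH0 : ∀ s, 0 ≤ H s := by
    intro s
    rcases le_total s 1 with h | h
    · exact intervalIntegral.integral_nonneg h fun a _ => hη0 a
    · rw [hH1 s h]
  have hHd : ContDiff ℝ 2 H := by
    have two : (2 : WithTop ℕ∞) = 1 + 1 := by norm_num
    rw [two, contDiff_succ_iff_deriv]
    refine ⟨fun s => (hH s).differentiableAt, by simp, ?_⟩
    have : deriv H = fun s => -η s := funext fun s => (hH s).deriv
    rw [this]
    exact hη.neg
  let K' : ℝ → EuclideanSpace ℝ (Fin n) → ℝ := fun t y =>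
    (((t ^ n)⁻¹ * (t / 2)) * (-(2 / t ^ 2) * (n * η (‖y - x‖ ^ 2 / t ^ 2) +
        2 * (‖y - x‖ ^ 2 / t ^ 2) * η' (‖y - x‖ ^ 2 / t ^ 2))))
  have hderiv : ∀ t ∈ Ioo 0 R, HasDerivAt
      (fun t => ∫ y in Metric.closedBall x R, f y * radialKernel η x t y)
      (∫ y in Metric.closedBall x R, f y * K' t y) t := by
    intro t ht
    have hA := isCompact_closedBall x R
    -- Keeping the scale at least `t / 2` avoids the singularity at 0; compactness then gives the
    -- uniform bound for differentiating under the integral.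
    have hK'c : ContinuousOn (fun p : ℝ × EuclideanSpace ℝ (Fin n) => K' p.1 p.2)
        (Icc (t / 2) R ×ˢ Metric.closedBall x R) := by
      have hne : ∀ p ∈ Icc (t / 2) R ×ˢ Metric.closedBall x R, p.1 ≠ 0 := by
        rintro ⟨a, b⟩ ⟨⟨h, -⟩, -⟩
        have := ht.1
        exact (by dsimp at h ⊢; linarith : (0 : ℝ) < a).ne'
      have hρ : ContinuousOn (fun p : ℝ × EuclideanSpace ℝ (Fin n) => ‖p.2 - x‖ ^ 2 / p.1 ^ 2)
          (Icc (t / 2) R ×ˢ Metric.closedBall x R) :=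
        ContinuousOn.div (by fun_prop) (by fun_prop) fun p hp => pow_ne_zero _ (hne p hp)
      have h1 : ContinuousOn (fun p : ℝ × EuclideanSpace ℝ (Fin n) => (p.1 ^ n)⁻¹)
          (Icc (t / 2) R ×ˢ Metric.closedBall x R) :=
        ContinuousOn.inv₀ (by fun_prop) fun p hp => pow_ne_zero _ (hne p hp)
      have h2 : ContinuousOn (fun p : ℝ × EuclideanSpace ℝ (Fin n) => 2 / p.1 ^ 2)
          (Icc (t / 2) R ×ˢ Metric.closedBall x R) :=
        ContinuousOn.div (by fun_prop) (by fun_prop) fun p hp => pow_ne_zero _ (hne p hp)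
      exact (h1.mul (by fun_prop)).mul (h2.neg.mul ((continuousOn_const.mul
        (hηc.comp_continuousOn hρ)).add ((continuousOn_const.mul hρ).mul
          (hη'c.comp_continuousOn hρ))))
    obtain ⟨C, hC⟩ := (isCompact_Icc.prod hA).exists_bound_of_continuousOn hK'c
    have hmeas : ∀ s, AEStronglyMeasurable (fun y => f y * radialKernel η x s y)
        (volume.restrict (Metric.closedBall x R)) := fun s =>
      hi.aestronglyMeasurable.mul
        (by unfold radialKernel; fun_prop : Continuous (radialKernel η x s)).aestronglyMeasurable
    refine (hasDerivAt_integral_of_dominated_loc_of_deriv_le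
      (F' := fun t y => f y * K' t y) (bound := fun y => ‖f y‖ * C)
      (Icc_mem_nhds (half_lt_self ht.1) ht.2) (Eventually.of_forall hmeas) ?_ ?_ ?_
      (hi.norm.mul_const C) ?_).2
    · exact hi.mul_continuousOn (by unfold radialKernel; fun_prop) hA
    · exact hi.aestronglyMeasurable.mul
        (by simp only [K']; fun_prop : Continuous (K' t)).aestronglyMeasurable
    · filter_upwards [ae_restrict_mem Metric.isClosed_closedBall.measurableSet] with y hy s hs
      rw [norm_mul]
      exact mul_le_mul_of_nonneg_left (hC (s, y) ⟨hs, hy⟩) (norm_nonneg _)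
    · refine Eventually.of_forall fun y s hs => ?_
      exact (hasDerivAt_radialKernel hηd x y (by linarith [ht.1, hs.1])).const_mul (f y)
  have hnonneg : ∀ t ∈ Ioo 0 R, 0 ≤ ∫ y in Metric.closedBall x R, f y * K' t y := by
    intro t ht
    have ht0 := ht.1
    let ψ : EuclideanSpace ℝ (Fin n) → ℝ := fun y => H (‖y - x‖ ^ 2 / t ^ 2)
    have hsupp : tsupport ψ ⊆ Metric.closedBall x t := by
      refine closure_minimal (fun y hy => ?_) Metric.isClosed_closedBall
      by_contra h
      refine hy (hH1 _ ?_)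
      rw [Metric.mem_closedBall, dist_eq_norm, not_le] at h
      rw [le_div_iff₀ (by positivity), one_mul]
      exact pow_le_pow_left₀ ht0.le h.le 2
    have hψ := hf ψ (hHd.comp (((contDiff_id.sub contDiff_const).norm_sq ℝ).div_const _))
      ((isCompact_closedBall x t).of_isClosed_subset (isClosed_tsupport _) hsupp)
      (hsupp.trans ((Metric.closedBall_subset_closedBall ht.2.le).trans hR)) (fun y => hH0 _)
    have hK : ∀ y, f y * K' t y = ((t ^ n)⁻¹ * (t / 2)) *
        (f y * ∑ j, partialDeriv j (partialDeriv j ψ) y) := by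
      intro y
      rw [sum_partialDeriv_partialDeriv_radial hH hηd]
      simp only [K']
      ring
    simp_rw [hK]
    rw [integral_const_mul, setIntegral_eq_integral_of_forall_compl_eq_zero]
    · positivity
    · intro y hy
      have : y ∉ tsupport ψ := fun h =>
        hy (Metric.closedBall_subset_closedBall ht.2.le (hsupp h))
      rw [Finset.sum_eq_zero, mul_zero]
      exact fun j _ => partialDeriv_partialDeriv_eq_zero_of_notMem_tsupport j this
  refine monotoneOn_of_deriv_nonneg (convex_Ioo 0 R)
    (fun t ht => (hderiv t ht).continuousAt.continuousWithinAt) ?_ ?_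
  · rw [interior_Ioo]
    exact fun t ht => (hderiv t ht).differentiableAt.differentiableWithinAt
  · rw [interior_Ioo]
    intro t ht
    rw [(hderiv t ht).deriv]
    exact hnonneg t ht

/-- The profiles lie in `[0, 1]` and tend to the indicator of `s < 1`, so dominated convergence
applies. -/
theorem tendsto_integral_radialKernel_smoothTransition {n : ℕ}
    {f : EuclideanSpace ℝ (Fin n) → ℝ} {x : EuclideanSpace ℝ (Fin n)} {t R : ℝ}
    (hi : IntegrableOn f (Metric.closedBall x R)) (ht : 0 < t) (htR : t ≤ R) :
    Tendsto (fun k : ℕ => ∫ y in Metric.closedBall x R,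
        f y * radialKernel (fun s => Real.smoothTransition (k * (1 - s))) x t y) atTop
      (𝓝 ((t ^ n)⁻¹ * ∫ y in Metric.ball x t, f y)) := by
  have hlim : (t ^ n)⁻¹ * ∫ y in Metric.ball x t, f y = ∫ y in Metric.closedBall x R,
      f y * ((t ^ n)⁻¹ * (Metric.ball x t).indicator (fun _ => 1) y) := by
    have : ∀ y, f y * ((t ^ n)⁻¹ * (Metric.ball x t).indicator (fun _ => (1 : ℝ)) y) =
        (t ^ n)⁻¹ * (Metric.ball x t).indicator f y := by
      intro y
      by_cases h : y ∈ Metric.ball x t <;> simp [h, mul_comm]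
    simp_rw [this]
    rw [integral_const_mul, setIntegral_indicator Metric.isOpen_ball.measurableSet,
      inter_eq_right.2 (Metric.ball_subset_closedBall.trans
        (Metric.closedBall_subset_closedBall htR))]
  rw [hlim]
  refine tendsto_integral_of_dominated_convergence (fun y => ‖f y‖ * (t ^ n)⁻¹) ?_
    (hi.norm.mul_const _) ?_ ?_
  · intro k
    refine hi.aestronglyMeasurable.mul (Continuous.aestronglyMeasurable ?_)
    have := Real.smoothTransition.continuous
    unfold radialKernel
    fun_prop
  · refine fun k => Eventually.of_forall fun y => ?_
    rw [norm_mul]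
    refine mul_le_mul_of_nonneg_left ?_ (norm_nonneg _)
    have := Real.smoothTransition.nonneg (k * (1 - ‖y - x‖ ^ 2 / t ^ 2))
    rw [radialKernel, Real.norm_of_nonneg (by positivity)]
    exact mul_le_of_le_one_right (by positivity) (Real.smoothTransition.le_one _)
  · refine Eventually.of_forall fun y => (Tendsto.const_mul _ (Tendsto.const_mul _ ?_))
    by_cases h : y ∈ Metric.ball x t
    · rw [indicator_of_mem h]
      have hlt : 0 < 1 - ‖y - x‖ ^ 2 / t ^ 2 := by
        rw [Metric.mem_ball, dist_eq_norm] at h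
        rw [sub_pos, div_lt_one (by positivity)]
        exact pow_lt_pow_left₀ h (norm_nonneg _) two_ne_zero
      refine tendsto_const_nhds.congr' ?_
      have hk := (tendsto_natCast_atTop_atTop (R := ℝ)).atTop_mul_const hlt
      filter_upwards [hk.eventually_ge_atTop 1] with k hk
      exact (Real.smoothTransition.one_of_one_le hk).symm
    · rw [indicator_of_notMem h]
      refine tendsto_const_nhds.congr fun k => (Real.smoothTransition.zero_of_nonpos ?_).symm
      rw [Metric.mem_ball, dist_eq_norm, not_lt] at h
      refine mul_nonpos_of_nonneg_of_nonpos (Nat.cast_nonneg k) (sub_nonpos.2 ?_)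
      rw [le_div_iff₀ (by positivity), one_mul]
      exact pow_le_pow_left₀ ht.le h 2

theorem setAverage_closedBall_eq {m : ℕ} (f : EuclideanSpace ℝ (Fin (m + 1)) → ℝ)
    (x : EuclideanSpace ℝ (Fin (m + 1))) {r : ℝ} (hr : 0 ≤ r) :
    ⨍ y in Metric.closedBall x r, f y =
      (volume.real (Metric.ball (0 : EuclideanSpace ℝ (Fin (m + 1))) 1))⁻¹ *
        ((r ^ (m + 1))⁻¹ * ∫ y in Metric.ball x r, f y) := by
  rw [setAverage_eq, smul_eq_mul, Measure.addHaar_real_closedBall volume x hr,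
    finrank_euclideanSpace, Fintype.card_fin, mul_inv, mul_comm ((r ^ (m + 1))⁻¹), mul_assoc]
  congr 2
  refine setIntegral_congr_set ?_
  have h := Measure.addHaar_sphere volume x r
  rw [← Metric.closedBall_sdiff_ball] at h
  exact (Metric.ball_subset_closedBall.eventuallyLE.antisymm (ae_le_set.2 h)).symm

theorem exists_closedBall_subset_of_closedBall_subset {n : ℕ}
    {Ω : Set (EuclideanSpace ℝ (Fin n))} (hΩ : IsOpen Ω) {x : EuclideanSpace ℝ (Fin n)} {r : ℝ}
    (hr : 0 ≤ r) (h : Metric.closedBall x r ⊆ Ω) :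
    ∃ R, r < R ∧ Metric.closedBall x R ⊆ Ω := by
  obtain ⟨δ, hδ, hsub⟩ := (isCompact_closedBall x r).exists_cthickening_subset_open hΩ h
  refine ⟨r + δ, by linarith, ?_⟩
  rwa [cthickening_closedBall hδ.le hr, add_comm] at hsub

/-- Limit of the smooth case; a ball of radius `R > r` still inside `Ω` puts `r` in the open
interval of monotonicity. -/
theorem WeaklySubharmonicOn.setAverage_mono {m : ℕ}
    {f : EuclideanSpace ℝ (Fin (m + 1)) → ℝ} {Ω : Set (EuclideanSpace ℝ (Fin (m + 1)))}
    (hf : WeaklySubharmonicOn f Ω) (hΩ : IsOpen Ω) (hi : LocallyIntegrableOn f Ω)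
    {x : EuclideanSpace ℝ (Fin (m + 1))} {s r : ℝ} (hs : 0 < s) (hsr : s ≤ r)
    (hr : Metric.closedBall x r ⊆ Ω) :
    ⨍ y in Metric.closedBall x s, f y ≤ ⨍ y in Metric.closedBall x r, f y := by
  obtain ⟨R, hrR, hR⟩ := exists_closedBall_subset_of_closedBall_subset hΩ (hs.le.trans hsr) hr
  have hiR := hi.integrableOn_compact_subset hR (isCompact_closedBall x R)
  rw [setAverage_closedBall_eq f x hs.le, setAverage_closedBall_eq f x (hs.le.trans hsr)]
  refine mul_le_mul_of_nonneg_left ?_ (by positivity)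
  refine le_of_tendsto_of_tendsto'
    (tendsto_integral_radialKernel_smoothTransition hiR hs (hsr.trans hrR.le))
    (tendsto_integral_radialKernel_smoothTransition hiR (hs.trans_le hsr) hrR.le) fun k => ?_
  refine hf.monotoneOn_integral_radialKernel hR hiR ?_ (fun s => Real.smoothTransition.nonneg _)
    (fun s hs => Real.smoothTransition.zero_of_nonpos
      (mul_nonpos_of_nonneg_of_nonpos (Nat.cast_nonneg k) (sub_nonpos.2 hs)))
    ⟨hs, hsr.trans_lt hrR⟩ ⟨hs.trans_le hsr, hrR⟩ hsr
  exact (Real.smoothTransition.contDiff (n := 1)).comp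
    (contDiff_const.mul (contDiff_const.sub contDiff_id))

/-! ### Classical Laplacians -/

theorem volume_eq_zero_of_hausdorffMeasure_eq_zero {m : ℕ}
    {E : Set (EuclideanSpace ℝ (Fin (m + 1)))} (hE : Measure.hausdorffMeasure (m : ℝ) E = 0) :
    volume E = 0 := by
  have h1 : Measure.hausdorffMeasure ((Fintype.card (Fin (m + 1)) : ℕ) : ℝ) E = 0 := by
    refine le_antisymm ((Measure.hausdorffMeasure_mono ?_ E).trans hE.le) bot_le
    simp
  have h2 := (PiLp.lipschitzWith_ofLp 2 (fun _ : Fin (m + 1) => ℝ)).hausdorffMeasure_image_le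
    (Nat.cast_nonneg (Fintype.card (Fin (m + 1)))) E
  rw [h1, mul_zero, nonpos_iff_eq_zero, hausdorffMeasure_pi_real] at h2
  rw [← (EuclideanSpace.volume_preserving_symm_measurableEquiv_toLp
    (Fin (m + 1))).symm.measure_preimage_equiv]
  refine measure_mono_null (fun y hy => ?_) h2
  exact ⟨_, hy, rfl⟩

/-- Both derivatives move from the test function to `u` one coordinate at a time. The case `E = ∅`
also serves for C² comparison functions. -/
theorem weaklySubharmonicOn_of_sum_partialDeriv_nonneg {m : ℕ}
    {Ω E : Set (EuclideanSpace ℝ (Fin (m + 1)))} (hΩ : IsOpen Ω) (hU : IsOpen (Ω \ E))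
    (hE : Measure.hausdorffMeasure (m : ℝ) E = 0) {u : EuclideanSpace ℝ (Fin (m + 1)) → ℝ}
    (hu : LocallyIntegrableOn u Ω) (hu2 : ContDiffOn ℝ 2 u (Ω \ E))
    (hu3 : ∀ j, LocallyIntegrableOn (partialDeriv j (partialDeriv j u)) Ω)
    (hpos : ∀ x ∈ Ω \ E, 0 ≤ ∑ j, partialDeriv j (partialDeriv j u) x) :
    WeaklySubharmonicOn u Ω := by
  intro φ hφ hc hsub hφ0
  have two : (2 : WithTop ℕ∞) = 0 + 1 + 1 := by norm_num
  have hφ2 : ∀ j, Continuous (partialDeriv j (partialDeriv j φ)) := by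
    intro j
    rw [two] at hφ
    exact ((hφ.partialDeriv j).partialDeriv j).continuous
  simp_rw [Finset.mul_sum]
  rw [integral_finsetSum _ fun j _ => hu.integrable_mul_of_compact hc hsub (hφ2 j)
      fun x hx => partialDeriv_partialDeriv_eq_zero_of_notMem_tsupport j hx,
    Finset.sum_congr rfl fun j _ => integral_mul_partialDeriv_partialDeriv j hΩ hU hE hu hu2
      (hu3 j) hφ hc hsub,
    ← integral_finsetSum _ fun j _ => (hu3 j).integrable_mul_of_compact hc hsub hφ.continuous
      fun x hx => image_eq_zero_of_notMem_tsupport hx]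
  refine integral_nonneg_of_ae ?_
  filter_upwards [measure_eq_zero_iff_ae_notMem.1 (volume_eq_zero_of_hausdorffMeasure_eq_zero hE)]
    with x hx
  rw [← Finset.sum_mul]
  by_cases h : x ∈ Ω
  · exact mul_nonneg (hpos x ⟨h, hx⟩) (hφ0 x)
  · rw [image_eq_zero_of_notMem_tsupport fun h' => h (hsub h'), mul_zero]
    exact le_rfl

theorem partialDeriv_neg_sub {n : ℕ} {f g : EuclideanSpace ℝ (Fin n) → ℝ}
    {x : EuclideanSpace ℝ (Fin n)} (j : Fin n) (hf : DifferentiableAt ℝ f x)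
    (hg : DifferentiableAt ℝ g x) :
    partialDeriv j (fun y => -f y - g y) x = -partialDeriv j f x - partialDeriv j g x := by
  have h := (hf.hasFDerivAt.neg.sub hg.hasFDerivAt)
  rw [partialDeriv_eq_fderiv j hf, partialDeriv_eq_fderiv j hg]
  exact (partialDeriv_eq_fderiv j h.differentiableAt).trans (by rw [h.fderiv]; simp)

theorem partialDeriv_partialDeriv_neg_sub {n : ℕ} {f g : EuclideanSpace ℝ (Fin n) → ℝ}
    {U : Set (EuclideanSpace ℝ (Fin n))} (hU : IsOpen U) (hf : ContDiffOn ℝ 2 f U)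
    (hg : ContDiffOn ℝ 2 g U) (j : Fin n) {x : EuclideanSpace ℝ (Fin n)} (hx : x ∈ U) :
    partialDeriv j (partialDeriv j fun y => -f y - g y) x =
      -partialDeriv j (partialDeriv j f) x - partialDeriv j (partialDeriv j g) x := by
  have two : (2 : WithTop ℕ∞) = 1 + 1 := by norm_num
  have h : (partialDeriv j fun y => -f y - g y) =ᶠ[𝓝 x]
      fun y => -partialDeriv j f y - partialDeriv j g y := by
    filter_upwards [hU.mem_nhds hx] with y hy
    exact partialDeriv_neg_sub j ((hf.differentiableOn (by simp)).differentiableAt (hU.mem_nhds hy))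
      ((hg.differentiableOn (by simp)).differentiableAt (hU.mem_nhds hy))
  have hd : ∀ {f : EuclideanSpace ℝ (Fin n) → ℝ}, ContDiffOn ℝ 2 f U →
      DifferentiableAt ℝ (partialDeriv j f) x := by
    intro f hf
    rw [two] at hf
    exact ((hf.partialDeriv hU j).differentiableOn (by simp)).differentiableAt (hU.mem_nhds hx)
  refine Eq.trans ?_ (partialDeriv_neg_sub j (hd hf) (hd hg))
  exact h.lineDeriv_eq

/-- By monotonicity it suffices to look at small balls, whose means approach `f x` by continuity. -/
theorem WeaklySubharmonicOn.le_setAverage_of_continuousAt {m : ℕ}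
    {f : EuclideanSpace ℝ (Fin (m + 1)) → ℝ} {Ω : Set (EuclideanSpace ℝ (Fin (m + 1)))}
    (hf : WeaklySubharmonicOn f Ω) (hΩ : IsOpen Ω) (hi : LocallyIntegrableOn f Ω)
    {x : EuclideanSpace ℝ (Fin (m + 1))} (hx : ContinuousAt f x) {r : ℝ} (hr : 0 < r)
    (hsub : Metric.closedBall x r ⊆ Ω) : f x ≤ ⨍ y in Metric.closedBall x r, f y := by
  refine le_of_forall_lt fun a ha => ?_
  obtain ⟨s, hs, hsa⟩ := Metric.nhds_basis_closedBall.eventually_iff.1 (hx.eventually_const_lt ha)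
  have hle : min s r ≤ r := min_le_right s r
  have h0 : 0 < min s r := lt_min hs hr
  refine lt_of_lt_of_le ?_ (hf.setAverage_mono hΩ hi h0 hle hsub)
  obtain ⟨y, hy, hya⟩ := exists_le_setAverage
    (Metric.measure_closedBall_pos volume x h0).ne' measure_closedBall_lt_top.ne
    (hi.integrableOn_compact_subset ((Metric.closedBall_subset_closedBall hle).trans hsub)
      (isCompact_closedBall _ _))
  exact (hsa (Metric.closedBall_subset_closedBall (min_le_left s r) hy)).trans_le hya

/-- Were the Laplacian negative at `x`, `w = -u - c|y - x|²` would have positive Laplacian nearby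
and so satisfy the mean inequality at `x`. Then `u x` would exceed its mean by at least the mean of
`c|y - x|²`, which is positive. -/
theorem sum_partialDeriv_partialDeriv_nonneg_of_le_setAverage {m : ℕ}
    {u : EuclideanSpace ℝ (Fin (m + 1)) → ℝ} {U : Set (EuclideanSpace ℝ (Fin (m + 1)))}
    (hU : IsOpen U) (hu : ContDiffOn ℝ 2 u U) {x : EuclideanSpace ℝ (Fin (m + 1))} (hx : x ∈ U)
    (hmean : ∀ r, 0 < r → Metric.closedBall x r ⊆ U →
      u x ≤ ⨍ y in Metric.closedBall x r, u y) :
    0 ≤ ∑ j, partialDeriv j (partialDeriv j u) x := by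
  by_contra! hneg
  have two : (2 : WithTop ℕ∞) = 0 + 1 + 1 := by norm_num
  have hcont : ∀ {f : EuclideanSpace ℝ (Fin (m + 1)) → ℝ} {V}, IsOpen V → ContDiffOn ℝ 2 f V →
      ∀ j, ContinuousOn (partialDeriv j (partialDeriv j f)) V := by
    intro f V hV hf j
    rw [two] at hf
    exact ((hf.partialDeriv hV j).partialDeriv hV j).continuousOn
  set L := ∑ j, partialDeriv j (partialDeriv j u) x with hL
  obtain ⟨c, hc, hcL⟩ : ∃ c : ℝ, 0 < c ∧ L < -(c * (2 * (m + 1))) := by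
    -- With this `c` the quadratic term has Laplacian `-L / 2`, half of what `-u` offers at `x`.
    refine ⟨-L / (4 * (m + 1)), div_pos (by linarith) (by positivity), ?_⟩
    field_simp
    linarith
  have hLc : ContinuousAt (fun y => ∑ j, partialDeriv j (partialDeriv j u) y) x :=
    (continuousOn_finsetSum _ fun j _ => hcont hU hu j).continuousAt (hU.mem_nhds hx)
  obtain ⟨R, hR, hRU⟩ := Metric.nhds_basis_ball.eventually_iff.1
    ((hLc.eventually_lt_const hcL).and (hU.mem_nhds hx))
  let B := Metric.ball x R
  have hB : IsOpen B := Metric.isOpen_ball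
  have huB : ContDiffOn ℝ 2 u B := hu.mono fun y hy => (hRU hy).2
  -- The division by `1 ^ 2` matches the radial Laplacian formula at scale `t = 1`.
  let q : EuclideanSpace ℝ (Fin (m + 1)) → ℝ := fun y => c * (‖y - x‖ ^ 2 / 1 ^ 2)
  have hq : ContDiff ℝ 2 q :=
    contDiff_const.mul (((contDiff_id.sub contDiff_const).norm_sq ℝ).div_const _)
  have hqL : ∀ y, ∑ j, partialDeriv j (partialDeriv j q) y = c * (2 * (m + 1)) := by
    intro y
    have h := sum_partialDeriv_partialDeriv_radial (H := fun s => c * s) (η := fun _ => -c)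
      (η' := fun _ => 0) (t := 1) (fun s => by simpa using (hasDerivAt_id s).const_mul c)
      (fun s => hasDerivAt_const s _) x y
    refine h.trans ?_
    push_cast
    ring
  let w : EuclideanSpace ℝ (Fin (m + 1)) → ℝ := fun y => -u y - q y
  have hw : ContDiffOn ℝ 2 w B := huB.neg.sub hq.contDiffOn
  have hwi : LocallyIntegrableOn w B :=
    hw.continuousOn.locallyIntegrableOn hB.measurableSet
  have hws : WeaklySubharmonicOn w B := by
    refine weaklySubharmonicOn_of_sum_partialDeriv_nonneg (E := ∅) hB (by simpa using hB)
      (by simp) hwi (by simpa using hw)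
      (fun j => (hcont hB hw j).locallyIntegrableOn hB.measurableSet) ?_
    rintro y ⟨hy, -⟩
    rw [Finset.sum_congr rfl fun j _ =>
      partialDeriv_partialDeriv_neg_sub hB huB hq.contDiffOn j hy, Finset.sum_sub_distrib,
      Finset.sum_neg_distrib, hqL]
    have := (hRU hy).1
    linarith
  have hr : 0 < R / 2 := half_pos hR
  have hrB : Metric.closedBall x (R / 2) ⊆ B :=
    Metric.closedBall_subset_ball (half_lt_self hR)
  have h1 := hws.le_setAverage_of_continuousAt hB hwi
    (hw.continuousOn.continuousAt (hB.mem_nhds (Metric.mem_ball_self hR))) hr hrB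
  have h2 := hmean (R / 2) hr fun y hy => (hRU (hrB hy)).2
  have hcB := isCompact_closedBall x (R / 2)
  have hiu : IntegrableOn u (Metric.closedBall x (R / 2)) :=
    (huB.continuousOn.mono hrB).integrableOn_compact hcB
  have hiq : IntegrableOn q (Metric.closedBall x (R / 2)) :=
    hq.continuous.continuousOn.integrableOn_compact hcB
  have hqpos : 0 < ∫ y in Metric.closedBall x (R / 2), q y := by
    rw [setIntegral_pos_iff_support_of_nonneg_ae
      (Eventually.of_forall fun y => by simp only [q, Pi.zero_apply]; positivity) hiq]
    have hsub : Metric.closedBall x (R / 2) \ {x} ⊆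
        Function.support q ∩ Metric.closedBall x (R / 2) := by
      rintro y ⟨hy, hyx⟩
      refine ⟨?_, hy⟩
      have : 0 < ‖y - x‖ := norm_pos_iff.2 (sub_ne_zero.2 hyx)
      simp only [Function.mem_support, q]
      positivity
    refine lt_of_lt_of_le ?_ (measure_mono hsub)
    rw [measure_sdiff_null (measure_singleton x)]
    exact Metric.measure_closedBall_pos volume x hr
  have hV : 0 < volume.real (Metric.closedBall x (R / 2)) :=
    ENNReal.toReal_pos (Metric.measure_closedBall_pos volume x hr).ne' measure_closedBall_lt_top.ne
  simp only [setAverage_eq, smul_eq_mul, w] at h1 h2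
  rw [integral_sub hiu.fun_neg hiq, integral_neg] at h1
  have h3 : q x = 0 := by simp [q]
  have h4 := mul_pos (inv_pos.2 hV) hqpos
  rw [h3] at h1
  nlinarith

/-! ### The regularisation by ball means -/

/-- Dominated convergence on the fixed ball of radius `R`: off the null sphere of radius `r` about
`x`, membership in the moving ball is locally constant in its centre. -/
theorem continuousAt_setAverage_closedBall {m : ℕ} {f : EuclideanSpace ℝ (Fin (m + 1)) → ℝ}
    {x : EuclideanSpace ℝ (Fin (m + 1))} {r R : ℝ} (hr : 0 ≤ r) (hrR : r < R)
    (hi : IntegrableOn f (Metric.closedBall x R)) :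
    ContinuousAt (fun z => ⨍ y in Metric.closedBall z r, f y) x := by
  simp_rw [setAverage_closedBall_eq f _ hr]
  refine continuousAt_const.mul (continuousAt_const.mul ?_)
  have h : ContinuousAt (fun z => ∫ y in Metric.closedBall x R,
      (Metric.ball z r).indicator f y) x := by
    refine continuousAt_of_dominated (bound := fun y => ‖f y‖) ?_ ?_ hi.norm ?_
    · exact Eventually.of_forall fun z =>
        hi.aestronglyMeasurable.indicator Metric.isOpen_ball.measurableSet
    · exact Eventually.of_forall fun z => Eventually.of_forall fun y =>
        norm_indicator_le_norm_self f y
    · refine ae_restrict_of_ae ?_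
      filter_upwards [measure_eq_zero_iff_ae_notMem.1 (Measure.addHaar_sphere volume x r)]
        with y hy
      have hd : ContinuousAt (fun z => dist y z) x := by fun_prop
      rcases lt_or_gt_of_ne hy with h | h
      · refine (continuousAt_const (y := f y)).congr ?_
        filter_upwards [hd.eventually_lt_const h] with z hz
        exact (indicator_of_mem (Metric.mem_ball.2 hz) f).symm
      · refine (continuousAt_const (y := (0 : ℝ))).congr ?_
        filter_upwards [hd.eventually_const_lt h] with z hz
        exact (indicator_of_notMem (fun h' => lt_asymm hz (Metric.mem_ball.1 h')) f).symm
  refine h.congr ?_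
  filter_upwards [Metric.ball_mem_nhds x (sub_pos.2 hrR)] with z hz
  rw [setIntegral_indicator Metric.isOpen_ball.measurableSet, inter_eq_right.2]
  refine Metric.ball_subset_closedBall.trans (Metric.closedBall_subset_closedBall' ?_)
  rw [Metric.mem_ball] at hz
  linarith

theorem ballMean_coe {n : ℕ} {f : EuclideanSpace ℝ (Fin n) → ℝ}
    {x : EuclideanSpace ℝ (Fin n)} {r : ℝ} (hi : IntegrableOn f (Metric.closedBall x r)) :
    ballMean (fun y => (f y : EReal)) x r =
      ((⨍ y in Metric.closedBall x r, f y : ℝ) : EReal) := by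
  have h1 : ∫⁻ y in Metric.closedBall x r, ENNReal.ofReal (f y) ≠ ⊤ :=
    ((lintegral_ofReal_le_lintegral_enorm _).trans_lt hi.2).ne
  have h2 : ∫⁻ y in Metric.closedBall x r, ENNReal.ofReal (-f y) ≠ ⊤ :=
    ((lintegral_ofReal_le_lintegral_enorm _).trans_lt hi.neg.2).ne
  rw [ballMean, extIntegral]
  simp only [← EReal.coe_neg, EReal.real_coe_toENNReal]
  rw [setAverage_eq, integral_eq_lintegral_pos_part_sub_lintegral_neg_part hi, smul_eq_mul,
    ← div_eq_inv_mul, EReal.coe_div, EReal.coe_sub, EReal.coe_ennreal_toReal h1,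
    EReal.coe_ennreal_toReal h2]

theorem ballMean_congr_ae {n : ℕ} {f g : EuclideanSpace ℝ (Fin n) → EReal}
    {x : EuclideanSpace ℝ (Fin n)} {r : ℝ}
    (h : f =ᵐ[volume.restrict (Metric.closedBall x r)] g) : ballMean f x r = ballMean g x r := by
  have h1 : ∫⁻ y in Metric.closedBall x r, (f y).toENNReal =
      ∫⁻ y in Metric.closedBall x r, (g y).toENNReal :=
    lintegral_congr_ae (by filter_upwards [h] with y hy; rw [hy])
  have h2 : ∫⁻ y in Metric.closedBall x r, (-f y).toENNReal =
      ∫⁻ y in Metric.closedBall x r, (-g y).toENNReal :=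
    lintegral_congr_ae (by filter_upwards [h] with y hy; rw [hy])
  rw [ballMean, ballMean, extIntegral, extIntegral, h1, h2]

/-- The infimum of the means of `f` over all closed balls in `Ω` with a given centre. -/
noncomputable def infBallMean {n : ℕ} (f : EuclideanSpace ℝ (Fin n) → ℝ)
    (Ω : Set (EuclideanSpace ℝ (Fin n))) (x : EuclideanSpace ℝ (Fin n)) : EReal :=
  ⨅ (r : ℝ) (_ : 0 < r ∧ Metric.closedBall x r ⊆ Ω),
    ((⨍ y in Metric.closedBall x r, f y : ℝ) : EReal)

theorem infBallMean_le {n : ℕ} {f : EuclideanSpace ℝ (Fin n) → ℝ}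
    {Ω : Set (EuclideanSpace ℝ (Fin n))} {x : EuclideanSpace ℝ (Fin n)} {r : ℝ} (hr : 0 < r)
    (h : Metric.closedBall x r ⊆ Ω) :
    infBallMean f Ω x ≤ ((⨍ y in Metric.closedBall x r, f y : ℝ) : EReal) :=
  iInf₂_le r ⟨hr, h⟩

/-- A radius that nearly attains the infimum at `x` stays admissible for nearby centres, thanks to a
slightly larger ball in `Ω`, and its mean varies continuously. -/
theorem upperSemicontinuousOn_infBallMean {m : ℕ} {f : EuclideanSpace ℝ (Fin (m + 1)) → ℝ}
    {Ω : Set (EuclideanSpace ℝ (Fin (m + 1)))} (hΩ : IsOpen Ω) (hi : LocallyIntegrableOn f Ω) :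
    UpperSemicontinuousOn (infBallMean f Ω) Ω := by
  intro x hx c hc
  dsimp only [infBallMean] at hc
  simp only [iInf_lt_iff] at hc
  obtain ⟨r, ⟨hr, hsub⟩, hlt⟩ := hc
  obtain ⟨R, hrR, hR⟩ := exists_closedBall_subset_of_closedBall_subset hΩ hr.le hsub
  have hcont := continuousAt_setAverage_closedBall hr.le hrR
    (hi.integrableOn_compact_subset hR (isCompact_closedBall x R))
  refine mem_nhdsWithin_of_mem_nhds ?_
  filter_upwards [(continuous_coe_real_ereal.continuousAt.comp hcont).eventually_lt_const hlt,
    Metric.ball_mem_nhds x (sub_pos.2 hrR)] with z hz hzR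
  refine (infBallMean_le hr ((Metric.closedBall_subset_closedBall' ?_).trans hR)).trans_lt hz
  rw [Metric.mem_ball] at hzR
  linarith

theorem WeaklySubharmonicOn.infBallMean_eq_of_continuousAt {m : ℕ}
    {f : EuclideanSpace ℝ (Fin (m + 1)) → ℝ} {Ω : Set (EuclideanSpace ℝ (Fin (m + 1)))}
    (hf : WeaklySubharmonicOn f Ω) (hΩ : IsOpen Ω) (hi : LocallyIntegrableOn f Ω)
    {x : EuclideanSpace ℝ (Fin (m + 1))} (hx : x ∈ Ω) (hc : ContinuousAt f x) :
    infBallMean f Ω x = f x := by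
  refine le_antisymm ?_ (le_iInf₂ fun r hr => EReal.coe_le_coe_iff.2
    (hf.le_setAverage_of_continuousAt hΩ hi hc hr.1 hr.2))
  refine EReal.le_of_forall_lt_iff_le.1 fun a ha => ?_
  have ha' : f x < a := EReal.coe_lt_coe_iff.1 ha
  obtain ⟨s, hs, hsa⟩ := Metric.nhds_basis_closedBall.eventually_iff.1
    ((hc.eventually_lt_const ha').and (hΩ.mem_nhds hx))
  refine (infBallMean_le hs fun y hy => (hsa hy).2).trans (EReal.coe_le_coe_iff.2 ?_)
  obtain ⟨y, hy, hya⟩ := exists_setAverage_le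
    (Metric.measure_closedBall_pos volume x hs).ne' measure_closedBall_lt_top.ne
    (hi.integrableOn_compact_subset (fun y hy => (hsa hy).2) (isCompact_closedBall _ _))
  exact hya.trans (hsa hy).1.le

theorem corollary3 (n : ℕ) (hn : 2 ≤ n)
    (Ω : Set (EuclideanSpace ℝ (Fin n))) (hΩo : IsOpen Ω) (hΩc : IsConnected Ω)
    (E : Set (EuclideanSpace ℝ (Fin n))) (hEΩ : E ⊆ Ω)
    (hEc : IsClosed ((Subtype.val : Ω → EuclideanSpace ℝ (Fin n)) ⁻¹' E))
    (hE0 : Measure.hausdorffMeasure ((n : ℝ) - 1) E = 0)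
    (u : EuclideanSpace ℝ (Fin n) → ℝ)
    (hu : SubharmonicOn (fun x => (u x : EReal)) (Ω \ E))
    (hu1 : LocallyIntegrableOn u Ω volume)
    (hu2 : ContDiffOn ℝ 2 u (Ω \ E))
    (hu3 : ∀ j : Fin n, LocallyIntegrableOn (partialDeriv j (partialDeriv j u)) Ω volume) :
    ∃ v : EuclideanSpace ℝ (Fin n) → EReal,
      SubharmonicOn v Ω ∧ ∀ x ∈ Ω \ E, v x = (u x : EReal) := by
  obtain ⟨m, rfl⟩ : ∃ m, n = m + 1 := ⟨n - 1, by omega⟩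
  have hE : Measure.hausdorffMeasure (m : ℝ) E = 0 := by
    rwa [Nat.cast_add, Nat.cast_one, add_sub_cancel_right] at hE0
  have hU : IsOpen (Ω \ E) := by
    have h := hΩo.isOpenMap_subtype_val _ hEc.isOpen_compl
    rwa [← preimage_compl, Subtype.image_preimage_coe, ← Set.sdiff_eq] at h
  have hlap : ∀ x ∈ Ω \ E, 0 ≤ ∑ j, partialDeriv j (partialDeriv j u) x := by
    intro x hx
    refine sum_partialDeriv_partialDeriv_nonneg_of_le_setAverage hU hu2 hx fun r hr hsub => ?_
    have h := hu.le_ballMean x hx r hr hsub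
    rwa [ballMean_coe ((hu2.continuousOn.mono hsub).integrableOn_compact
      (isCompact_closedBall x r)), EReal.coe_le_coe_iff] at h
  have hw : WeaklySubharmonicOn u Ω :=
    weaklySubharmonicOn_of_sum_partialDeriv_nonneg hΩo hU hE hu1 hu2 hu3 hlap
  have hvu : ∀ x ∈ Ω \ E, infBallMean u Ω x = (u x : EReal) := fun x hx =>
    hw.infBallMean_eq_of_continuousAt hΩo hu1 hx.1
      (hu2.continuousOn.continuousAt (hU.mem_nhds hx))
  have hEae := measure_eq_zero_iff_ae_notMem.1 (volume_eq_zero_of_hausdorffMeasure_eq_zero hE)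
  refine ⟨infBallMean u Ω, ⟨?_, upperSemicontinuousOn_infBallMean hΩo hu1, ?_, ?_⟩, hvu⟩
  · intro x hx
    obtain ⟨r, hr, hsub⟩ := Metric.nhds_basis_closedBall.mem_iff.1 (hΩo.mem_nhds hx)
    exact (infBallMean_le hr hsub).trans_lt (EReal.coe_lt_top _)
  · intro x hx r hr hsub
    -- The means of the extension are those of `u`, which bound the infimum from above.
    have hae : infBallMean u Ω =ᵐ[volume.restrict (Metric.closedBall x r)]
        fun y => (u y : EReal) := by
      filter_upwards [ae_restrict_of_ae hEae,
        ae_restrict_mem Metric.isClosed_closedBall.measurableSet] with y hyE hy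
      exact hvu y ⟨hsub hy, hyE⟩
    rw [ballMean_congr_ae hae,
      ballMean_coe (hu1.integrableOn_compact_subset hsub (isCompact_closedBall x r))]
    exact infBallMean_le hr hsub
  · intro x hx
    -- `Ω` is its own only component, and a null set cannot fill a nonempty open set; any point off
    -- `E` has a finite value.
    obtain ⟨y, hyΩ, hyE⟩ : (Ω \ E).Nonempty := by
      by_contra h
      rw [not_nonempty_iff_eq_empty, sdiff_eq_empty] at h
      exact (hΩo.measure_pos volume ⟨x, hx⟩).ne'
        (measure_mono_null h (volume_eq_zero_of_hausdorffMeasure_eq_zero hE))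
    refine ⟨y, ?_, ?_⟩
    · rwa [hΩc.isPreconnected.connectedComponentIn hx]
    · rw [hvu y ⟨hyΩ, hyE⟩]
      exact EReal.coe_ne_bot _
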